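/- Let $\Sigma_n=\{-1,1\}^n$ with Hamming distance $d_H$, and for $p\in\mathbb N$ let $\boldsymbol J=(J_{i_1,\dots,i_p})_{1\le i_1,\dots,i_p\le n}$ have i.i.d. standard normal entries. The Ising pure $p$-spin Hamiltonian is $$H(\boldsymbol\sigma)=n^{-\frac{p+1}{2}}\sum_{1\le i_1,\dots,i_p\le n}J_{i_1,\dots,i_p}\boldsymbol\sigma_{i_1}\cdots\boldsymbol\sigma_{i_p},\qquad \boldsymbol\sigma\in\Sigma_n,$$ and the Gibbs measure at inverse temperature $\beta$ is $\mu_\beta(A)=Z_\beta^{-1}\sum_{\boldsymbol\sigma\in A}e^{\beta nH(\boldsymbol\sigma)}$ with $Z_\beta=\sum_{\boldsymbol\sigma\in\Sigma_n}e^{\beta nH(\boldsymbol\sigma)}$. For nonempty $A,B\subseteq\Sigma_n$ put ${\rm diam}(A)=\max_{x,y\in A}d_H(x,y)$ and ${\rm dist}(A,B)=\min_{x\in A,y\in B}d_H(x,y)$. A $(\nu_1,\nu_2)$-clustering of $A\subseteq\Sigma_n$ is a partition $(\mathcal C_\ell)_{\ell=1}^L$ of $A$ into nonempty sets such that $d_H(\boldsymbol\sigma,\boldsymbol\sigma')\le\nu_1n$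 whenever $\boldsymbol\sigma,\boldsymbol\sigma'$ lie in the same $\mathcal C_i$, and $d_H(\boldsymbol\sigma,\boldsymbol\sigma')\ge\nu_2n$ whenever they lie in different $\mathcal C_i,\mathcal C_j$. **Theorem.** For any $\sqrt{\ln 2}<\beta<\sqrt{2\ln 2}$ there is a $\kappa_0>0$ such that for every $0<\kappa<\kappa_0$ there exist $P^*\in\mathbb N$, $0<\nu_1<\frac12\nu_2<\nu_2<1$ and $c,c'>0$ such that the following holds. For any $p\ge P^*$, the Gibbs measure is $(2\nu_1,\nu_2)$-shattered at inverse temperature $\beta$, with constants $c,c'$, and the clusters are a $(\nu_1,\nu_2)$-clustering of the energy band. That is, there is a deterministic sequence $\delta_n\to0$ such that with probability tending to $1$ as $n\to\infty$ (with $p$ fixed) there is a $(\nu_1,\nu_2)$-clustering $(\mathcal C_\ell)_{\ell=1}^L$ of $$\{\boldsymbol\sigma\in\Sigma_n:|H(\boldsymbol\sigma)-\beta|\le\kappa\sqrt{2\ln 2}\}$$ with the following properties: (a) $\frac1n\log_2L\ge c$; (b) $\max_{1\le i\le L}{\rm diam}(\mathcal C_i)\le 2\nu_1n$ and $\min_{1\le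 i<j\le L}{\rm dist}(\mathcal C_i,\mathcal C_j)\ge\nu_2n$; (c) $\max_{1\le i\le L}\mu_\beta(\mathcal C_i)\le e^{-c'n}$; (d) $\mu_\beta\bigl(\bigcup_{1\le i\le L}\mathcal C_i\bigr)\ge1-\delta_n$. -/

import Mathlib

namespace IsingPSpin

/-- The discrete cube `{-1, 1}^n`; the unit group `ℤˣ` is the two-point set `{-1, 1}`. -/
abbrev Config (n : ℕ) : Type := Fin n → ℤˣ

/-- Order-`p` tensors on `ℝ^n`: one real entry `J (i₁, …, i_p)` per multi-index. -/
abbrev Tensor (n p : ℕ) : Type := (Fin p → Fin n) → ℝ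

/-- The law of the disorder: the entries of the tensor are i.i.d. standard normal. -/
noncomputable def disorder (n p : ℕ) : MeasureTheory.Measure (Tensor n p) :=
  MeasureTheory.Measure.pi fun _ => ProbabilityTheory.gaussianReal 0 1

/-- The pure `p`-spin Hamiltonian
`H(σ) = n^{-(p+1)/2} ∑_{i₁,…,i_p} J_{i₁,…,i_p} σ_{i₁} ⋯ σ_{i_p}`. -/
noncomputable def hamiltonian {n p : ℕ} (J : Tensor n p) (σ : Config n) : ℝ :=
  (n : ℝ) ^ (-((p : ℝ) + 1) / 2) * ∑ I : Fin p → Fin n, J I * ∏ k : Fin p, ((σ (I k) : ℤ) : ℝ)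

/-- The partition function `Z_β = ∑_σ exp(β n H(σ))`. -/
noncomputable def partitionFunction {n p : ℕ} (β : ℝ) (J : Tensor n p) : ℝ :=
  ∑ σ : Config n, Real.exp (β * n * hamiltonian J σ)

/-- The Gibbs mass `μ_β(A) = Z_β⁻¹ ∑_{σ ∈ A} exp(β n H(σ))`. -/
noncomputable def gibbs {n p : ℕ} (β : ℝ) (J : Tensor n p) (A : Finset (Config n)) : ℝ :=
  (∑ σ ∈ A, Real.exp (β * n * hamiltonian J σ)) / partitionFunction β J

/-- The energy band `{σ : |H(σ) - β| ≤ κ √(2 ln 2)}`. -/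
noncomputable def energyBand {n p : ℕ} (β κ : ℝ) (J : Tensor n p) : Finset (Config n) :=
  Finset.univ.filter fun σ => |hamiltonian J σ - β| ≤ κ * √(2 * Real.log 2)

/-- The Hamming diameter of a set of configurations. -/
def diam {n : ℕ} (A : Finset (Config n)) : ℕ :=
  (A ×ˢ A).sup fun x => hammingDist x.1 x.2

/-- The Hamming distance between two (nonempty) sets of configurations: the minimum of the
pairwise Hamming distances. -/
noncomputable def setDist {n : ℕ} (A B : Finset (Config n)) : ℕ :=
  sInf {d : ℕ | ∃ x ∈ A, ∃ y ∈ B, hammingDist x y = d}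

/-- `C₁, …, C_L` is a `(ν₁, ν₂)`-clustering of `A`: a partition of `A` into nonempty parts, such
that points of one part are at Hamming distance at most `ν₁ n` and points of different parts are
at Hamming distance at least `ν₂ n`. -/
structure IsClustering {n L : ℕ} (ν₁ ν₂ : ℝ) (A : Finset (Config n))
    (C : Fin L → Finset (Config n)) : Prop where
  nonempty : ∀ i, (C i).Nonempty
  disjoint : ∀ i j, i ≠ j → Disjoint (C i) (C j)
  union : Finset.univ.biUnion C = A
  within : ∀ i, ∀ σ ∈ C i, ∀ σ' ∈ C i, (hammingDist σ σ' : ℝ) ≤ ν₁ * n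
  between : ∀ i j, i ≠ j → ∀ σ ∈ C i, ∀ σ' ∈ C j, ν₂ * n ≤ (hammingDist σ σ' : ℝ)

/-- For a given disorder `J`, the clusters `C₁, …, C_L` witness `(a, b)`-shattering of the Gibbs
measure at inverse temperature `β` with constants `c, c'`, up to a remaining Gibbs mass `δ`. -/
structure IsShatteredBy {n p L : ℕ} (β a b c c' δ : ℝ) (J : Tensor n p)
    (C : Fin L → Finset (Config n)) : Prop where
  nonempty : ∀ i, (C i).Nonempty
  exponentially_many : c ≤ 1 / (n : ℝ) * Real.logb 2 L
  confined : ∀ i, (diam (C i) : ℝ) ≤ a * n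
  separated : ∀ i j, i < j → b * n ≤ (setDist (C i) (C j) : ℝ)
  subdominant : ∀ i, gibbs β J (C i) ≤ Real.exp (-c' * n)
  collective : 1 - δ ≤ gibbs β J (Finset.univ.biUnion C)

end IsingPSpin

/-!
The energies `n H(σ)` are centered Gaussians with covariance `n R(σ, τ) ^ p`, `R` the overlap, and
for large `p` this covariance is negligible away from the caps of large `|R|`, which contain few
configurations. Discarding the energies above `n (β + η)`, where `η` is the half-width of the band,
makes the caps harmless in the second moment of `Z_β`, so `Z_β` is at least half of its mean with
high probability. Tilting the Boltzmann weights by `±η` shows that the energies outside the band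
contribute an exponentially small fraction of this mean.

If the distance of `σ` and `τ` lies strictly between `ν₁ n` and `ν₂ n`, then `R(σ, τ) ^ p` is tiny
and the two energies are nearly independent, so both are in the band with probability about
`exp (-n (β - η) ^ 2)`. As `β > √(log 2)`, this beats the `2 ^ n exp (o(n))` choices of such a pair:
the band has a gap in its distances, and being close is an equivalence relation whose classes are
the clusters. A cluster lies in a cap, so it has few configurations of energy at most `n (β + η)`,
and `β < √(2 log 2)` makes its Gibbs mass exponentially small. As the band carries most of the
mass, there are exponentially many clusters.
-/

namespace IsingPSpin

open MeasureTheory ProbabilityTheory Filter Topology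

/-! ### Product Gaussian measures and concentration -/

section Probability

lemma integrable_exp_sum_mul_pi_gaussianReal {ι : Type*} [Fintype ι] (m : ι → ℝ)
    (v : ι → NNReal) (a : ι → ℝ) :
    Integrable (fun x : ι → ℝ => Real.exp (∑ i, a i * x i))
      (Measure.pi fun i => gaussianReal (m i) (v i)) := by
  simp_rw [Real.exp_sum]
  exact Integrable.fintype_prod (f := fun i t => Real.exp (a i * t))
    fun i => integrable_exp_mul_gaussianReal (a i)

lemma integral_exp_sum_mul_pi_gaussianReal {ι : Type*} [Fintype ι] (m : ι → ℝ)
    (v : ι → NNReal) (a : ι → ℝ) :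
    ∫ x, Real.exp (∑ i, a i * x i) ∂(Measure.pi fun i => gaussianReal (m i) (v i))
      = Real.exp (∑ i, (m i * a i + v i * a i ^ 2 / 2)) := by
  simp_rw [Real.exp_sum]
  rw [integral_fintype_prod_eq_prod (f := fun i t => Real.exp (a i * t))]
  exact Finset.prod_congr rfl fun i _ => congrFun mgf_id_gaussianReal (a i)

lemma measureReal_lt_half_le_of_integral_sq_le {Ω : Type*} [MeasurableSpace Ω]
    {μ : Measure Ω} [IsProbabilityMeasure μ] {Z : Ω → ℝ} {M ε₁ ε₂ : ℝ} (hZ : MemLp Z 2 μ)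
    (hM : 0 < M) (h_mean : M * (1 - ε₁) ≤ ∫ ω, Z ω ∂μ)
    (h_sq : ∫ ω, Z ω ^ 2 ∂μ ≤ M ^ 2 * (1 + ε₂)) :
    μ.real {ω | Z ω < M / 2} ≤ 4 * (ε₂ + 2 * ε₁) := by
  have hZ_int : Integrable Z μ := hZ.integrable one_le_two
  have h_dev : ∫ ω, (Z ω - M) ^ 2 ∂μ ≤ M ^ 2 * (ε₂ + 2 * ε₁) := by
    have h_expand : ∫ ω, (Z ω - M) ^ 2 ∂μ
        = ∫ ω, Z ω ^ 2 ∂μ - 2 * M * ∫ ω, Z ω ∂μ + M ^ 2 := by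
      have h_eq : (fun ω => (Z ω - M) ^ 2) = fun ω => Z ω ^ 2 - 2 * M * Z ω + M ^ 2 := by
        ext ω; ring
      rw [h_eq, integral_add (f := fun ω => Z ω ^ 2 - 2 * M * Z ω)
          (hZ.integrable_sq.sub (hZ_int.const_mul _)) (integrable_const _),
        integral_sub hZ.integrable_sq (hZ_int.const_mul _), integral_const_mul, integral_const,
        probReal_univ, one_smul]
    have := mul_le_mul_of_nonneg_left h_mean (by positivity : 0 ≤ 2 * M)
    rw [h_expand]
    linarith
  have h_markov := mul_meas_ge_le_integral_of_nonneg (.of_forall fun ω => sq_nonneg (Z ω - M))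
    (hZ.sub (memLp_const M)).integrable_sq (M ^ 2 / 4)
  have h_subset : {ω | Z ω < M / 2} ⊆ {ω | M ^ 2 / 4 ≤ (Z ω - M) ^ 2} := fun ω hω => by
    simp only [Set.mem_ofPred_eq] at hω ⊢
    nlinarith
  have h_mul : M ^ 2 / 4 * μ.real {ω | Z ω < M / 2} ≤ M ^ 2 / 4 * (4 * (ε₂ + 2 * ε₁)) :=
    calc M ^ 2 / 4 * μ.real {ω | Z ω < M / 2}
        ≤ M ^ 2 / 4 * μ.real {ω | M ^ 2 / 4 ≤ (Z ω - M) ^ 2} := by gcongr; finiteness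
      _ ≤ M ^ 2 * (ε₂ + 2 * ε₁) := h_markov.trans h_dev
      _ = M ^ 2 / 4 * (4 * (ε₂ + 2 * ε₁)) := by ring
  exact le_of_mul_le_mul_left h_mul (by positivity)

lemma tendsto_measure_one_of_measureReal_compl_le {Ω : ℕ → Type*}
    [∀ n, MeasurableSpace (Ω n)] {μ : ∀ n, Measure (Ω n)} [∀ n, IsProbabilityMeasure (μ n)]
    {S : ∀ n, Set (Ω n)} {b : ℕ → ℝ} (hb : Tendsto b atTop (𝓝 0))
    (hS : ∀ᶠ n in atTop, (μ n).real (S n)ᶜ ≤ b n) :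
    Tendsto (fun n => μ n (S n)) atTop (𝓝 1) := by
  have h_lower : Tendsto (fun n => ENNReal.ofReal (1 - b n)) atTop (𝓝 1) := by
    simpa using ENNReal.tendsto_ofReal (hb.const_sub 1)
  refine tendsto_of_tendsto_of_tendsto_of_le_of_le' h_lower tendsto_const_nhds ?_
    (.of_forall fun n => prob_le_one)
  filter_upwards [hS] with n hn
  have h_union := measureReal_union_le (μ := μ n) (S n) (S n)ᶜ
  rw [Set.union_compl_self, probReal_univ, measureReal_def] at h_union
  exact ENNReal.ofReal_le_of_le_toReal (by linarith)

lemma tendsto_exp_neg_mul_natCast {a : ℝ} (ha : 0 < a) :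
    Tendsto (fun n : ℕ => Real.exp (-(a * n))) atTop (𝓝 0) :=
  Real.tendsto_exp_neg_atTop_nhds_zero.comp
    (tendsto_natCast_atTop_atTop.const_mul_atTop ha)

lemma two_pow_eq_exp (n : ℕ) : (2 : ℝ) ^ n = Real.exp (n * Real.log 2) := by
  rw [Real.exp_nat_mul, Real.exp_log two_pos]

end Probability

variable {n p : ℕ}

/-! ### Overlaps -/

section Overlap

/-- The overlap `⟨σ, τ⟩ / n` of two configurations, equal to the junk value `0` if `n = 0`. -/
noncomputable def overlap (σ τ : Config n) : ℝ :=
  (∑ i, ((σ i : ℤ) : ℝ) * ((τ i : ℤ) : ℝ)) / n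

lemma natCast_mul_overlap (σ τ : Config n) :
    n * overlap σ τ = ∑ i, ((σ i : ℤ) : ℝ) * ((τ i : ℤ) : ℝ) := by
  rcases Nat.eq_zero_or_pos n with rfl | hn
  · simp
  · rw [overlap, mul_div_cancel₀ _ (by positivity)]

lemma natCast_mul_overlap_eq_sub (σ τ : Config n) :
    n * overlap σ τ = n - 2 * hammingDist σ τ := by
  have h_term (i : Fin n) :
      ((σ i : ℤ) : ℝ) * ((τ i : ℤ) : ℝ) = 1 - 2 * (if σ i ≠ τ i then 1 else 0) := by
    rcases Int.units_eq_one_or (σ i) with h | h <;>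
      rcases Int.units_eq_one_or (τ i) with h' | h' <;> norm_num [h, h']
  simp only [natCast_mul_overlap, h_term, Finset.sum_sub_distrib, ← Finset.mul_sum, hammingDist,
    Finset.sum_boole]
  simp

lemma hammingDist_le (σ τ : Config n) : hammingDist σ τ ≤ n := by
  simpa using hammingDist_le_card_fintype (x := σ) (y := τ)

lemma abs_overlap_le_one (σ τ : Config n) : |overlap σ τ| ≤ 1 := by
  have h_le : (hammingDist σ τ : ℝ) ≤ n := by exact_mod_cast hammingDist_le σ τ
  have h_nonneg : (0 : ℝ) ≤ hammingDist σ τ := Nat.cast_nonneg _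
  rw [overlap, ← natCast_mul_overlap, natCast_mul_overlap_eq_sub, abs_div, Nat.abs_cast]
  exact div_le_one_of_le₀ (abs_le.2 ⟨by linarith, by linarith [h_nonneg]⟩) (Nat.cast_nonneg _)

lemma natCast_mul_overlap_self_pow (p : ℕ) (σ : Config n) : (n : ℝ) * overlap σ σ ^ p = n := by
  rcases Nat.eq_zero_or_pos n with rfl | hn
  · simp
  · have h_self : overlap σ σ = 1 :=
      mul_left_cancel₀ (by positivity : (n : ℝ) ≠ 0) (by simp [natCast_mul_overlap_eq_sub])
    rw [h_self, one_pow, mul_one]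

lemma sum_exp_mul_overlap (l : ℝ) (σ : Config n) :
    ∑ τ, Real.exp (l * (n * overlap σ τ)) = (2 * Real.cosh l) ^ n := by
  have h_site (i : Fin n) :
      ∑ u : ℤˣ, Real.exp (l * (((σ i : ℤ) : ℝ) * ((u : ℤ) : ℝ))) = 2 * Real.cosh l := by
    rw [UnitsInt.univ, Finset.sum_pair (by decide), Real.cosh_eq]
    rcases Int.units_eq_one_or (σ i) with h | h <;> simp [h] <;> ring
  simp_rw [natCast_mul_overlap, Finset.mul_sum, Real.exp_sum]
  rw [← Fintype.prod_sum fun i (u : ℤˣ) => Real.exp (l * (((σ i : ℤ) : ℝ) * ((u : ℤ) : ℝ)))]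
  simp only [h_site, Finset.prod_const, Finset.card_univ, Fintype.card_fin]

lemma card_mul_exp_le_sum_exp {α : Type*} [Fintype α] {A : Finset α} {f : α → ℝ} {s : ℝ}
    (hA : ∀ a ∈ A, s ≤ f a) : A.card * Real.exp s ≤ ∑ a, Real.exp (f a) :=
  calc A.card * Real.exp s = ∑ _a ∈ A, Real.exp s := by simp
    _ ≤ ∑ a ∈ A, Real.exp (f a) := Finset.sum_le_sum fun a ha => Real.exp_le_exp.2 (hA a ha)
    _ ≤ ∑ a, Real.exp (f a) := Finset.sum_le_univ_sum_of_nonneg fun _ => (Real.exp_pos _).le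

lemma card_overlap_eq_mul_exp_le (r : ℝ) (σ : Config n) :
    (Finset.univ.filter fun τ => overlap σ τ = r).card * Real.exp (n * r ^ 2 / 2) ≤ 2 ^ n := by
  have h_chernoff := card_mul_exp_le_sum_exp (s := n * r ^ 2)
    (A := Finset.univ.filter fun τ => overlap σ τ = r) (f := fun τ => r * (n * overlap σ τ))
    fun τ hτ => by rw [(Finset.mem_filter.1 hτ).2]; apply le_of_eq; ring
  refine le_of_mul_le_mul_right (a := Real.exp (n * r ^ 2 / 2)) ?_ (Real.exp_pos _)
  calc _ = _ * Real.exp (n * r ^ 2) := by rw [mul_assoc, ← Real.exp_add, add_halves]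
    _ ≤ (2 * Real.cosh r) ^ n := by rwa [sum_exp_mul_overlap] at h_chernoff
    _ ≤ (2 * Real.exp (r ^ 2 / 2)) ^ n := by gcongr; exact Real.cosh_le_exp_half_sq r
    _ = 2 ^ n * Real.exp (n * r ^ 2 / 2) := by rw [mul_pow, ← Real.exp_nat_mul, mul_div_assoc]

-- The overlap takes `n + 1` values, and each contributes at most `2 ^ n` by the Chernoff bound.
lemma sum_exp_half_mul_sq_overlap_le (σ : Config n) :
    ∑ τ, Real.exp (n * overlap σ τ ^ 2 / 2) ≤ 2 ^ n * (n + 1) := by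
  have h_maps : ∀ τ ∈ (Finset.univ : Finset (Config n)),
      hammingDist σ τ ∈ Finset.range (n + 1) := fun τ _ =>
    Finset.mem_range_succ_iff.2 (hammingDist_le σ τ)
  have h_level (d : ℕ) :
      ∑ τ with hammingDist σ τ = d, Real.exp (n * overlap σ τ ^ 2 / 2) ≤ 2 ^ n := by
    have h_overlap : ∀ τ, hammingDist σ τ = d → overlap σ τ = (n - 2 * d) / n := fun τ hτ => by
      rw [overlap, ← natCast_mul_overlap, natCast_mul_overlap_eq_sub, hτ]
    calc _ = ∑ τ with hammingDist σ τ = d, Real.exp (n * ((n - 2 * d) / n) ^ 2 / 2) :=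
          Finset.sum_congr rfl fun τ hτ => by rw [h_overlap τ (Finset.mem_filter.1 hτ).2]
      _ ≤ (Finset.univ.filter fun τ => overlap σ τ = (n - 2 * d) / n).card
            * Real.exp (n * ((n - 2 * d) / n) ^ 2 / 2) := by
          rw [Finset.sum_const, nsmul_eq_mul]
          gcongr with τ
          exact h_overlap τ
      _ ≤ 2 ^ n := card_overlap_eq_mul_exp_le _ σ
  calc _ = ∑ d ∈ Finset.range (n + 1), ∑ τ with hammingDist σ τ = d,
        Real.exp (n * overlap σ τ ^ 2 / 2) := (Finset.sum_fiberwise_of_maps_to h_maps _).symm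
    _ ≤ ∑ _d ∈ Finset.range (n + 1), 2 ^ n := Finset.sum_le_sum fun d _ => h_level d
    _ = 2 ^ n * (n + 1) := by simp [mul_comm]

/-- The two opposite spherical caps around `σ` and `-σ`: the configurations whose overlap with `σ`
is at least `r` in absolute value. -/
noncomputable def overlapCap (r : ℝ) (σ : Config n) : Finset (Config n) :=
  Finset.univ.filter fun τ => r ≤ |overlap σ τ|

lemma mem_overlapCap {r : ℝ} {σ τ : Config n} : τ ∈ overlapCap r σ ↔ r ≤ |overlap σ τ| := by
  simp [overlapCap]

lemma overlapCap_anti {r s : ℝ} (h : r ≤ s) (σ : Config n) :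
    overlapCap s σ ⊆ overlapCap r σ := fun _ hτ =>
  mem_overlapCap.2 (h.trans (mem_overlapCap.1 hτ))

lemma mem_overlapCap_of_hammingDist_le (hn : 0 < n) {ν : ℝ} {σ τ : Config n}
    (h : hammingDist σ τ ≤ ν * n) : τ ∈ overlapCap (1 - 2 * ν) σ := by
  refine mem_overlapCap.2 (le_trans ?_ (le_abs_self _))
  refine le_of_mul_le_mul_left (a := (n : ℝ)) ?_ (by positivity)
  rw [natCast_mul_overlap_eq_sub]
  linarith

lemma two_mul_cosh_le (l : ℝ) : 2 * Real.cosh l ≤ Real.exp (l + Real.exp (-(2 * l))) :=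
  calc 2 * Real.cosh l = Real.exp l * (Real.exp (-(2 * l)) + 1) := by
        rw [Real.cosh_eq, mul_add, ← Real.exp_add]; ring_nf
    _ ≤ Real.exp l * Real.exp (Real.exp (-(2 * l))) := by gcongr; exact Real.add_one_le_exp _
    _ = Real.exp (l + Real.exp (-(2 * l))) := (Real.exp_add _ _).symm

lemma card_overlapCap_le {l : ℝ} (hl : 0 ≤ l) (r : ℝ) (σ : Config n) :
    ((overlapCap r σ).card : ℝ) ≤ 2 * Real.exp ((l * (1 - r) + Real.exp (-(2 * l))) * n) := by
  have h_chernoff := card_mul_exp_le_sum_exp (s := l * (n * r)) (A := overlapCap r σ)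
    (f := fun τ => |l * (n * overlap σ τ)|) fun τ hτ => by
      rw [abs_mul, abs_mul, abs_of_nonneg hl, Nat.abs_cast]
      gcongr
      exact mem_overlapCap.1 hτ
  refine le_of_mul_le_mul_right (a := Real.exp (l * (n * r))) ?_ (Real.exp_pos _)
  calc _ ≤ ∑ τ, Real.exp |l * (n * overlap σ τ)| := h_chernoff
    _ ≤ ∑ τ, (Real.exp (l * (n * overlap σ τ)) + Real.exp (-l * (n * overlap σ τ))) := by
      gcongr with τ
      rw [neg_mul]
      exact Real.exp_abs_le _
    _ = 2 * (2 * Real.cosh l) ^ n := by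
      rw [Finset.sum_add_distrib, sum_exp_mul_overlap, sum_exp_mul_overlap, Real.cosh_neg]
      ring
    _ ≤ 2 * Real.exp (l + Real.exp (-(2 * l))) ^ n := by gcongr; exact two_mul_cosh_le l
    _ = _ := by
      rw [← Real.exp_nat_mul, mul_assoc, ← Real.exp_add]
      ring_nf

lemma exists_card_overlapCap_le {ε : ℝ} (hε : 0 < ε) :
    ∃ r < 1, ∀ (n : ℕ) (σ : Config n), ((overlapCap r σ).card : ℝ) ≤ 2 * Real.exp (ε * n) := by
  have h_lim : Tendsto (fun l : ℝ => Real.exp (-(2 * l))) atTop (𝓝 0) :=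
    Real.tendsto_exp_neg_atTop_nhds_zero.comp (tendsto_id.const_mul_atTop two_pos)
  obtain ⟨l, hl, hlε⟩ := ((eventually_gt_atTop 0).and
    (h_lim.eventually_le_const (half_pos hε))).exists
  refine ⟨1 - ε / (2 * l), by linarith [show 0 < ε / (2 * l) by positivity], fun n σ => ?_⟩
  refine (card_overlapCap_le hl.le _ σ).trans ?_
  gcongr
  calc l * (1 - (1 - ε / (2 * l))) + Real.exp (-(2 * l)) = ε / 2 + Real.exp (-(2 * l)) := by
        field_simp; ring
    _ ≤ ε := by linarith

end Overlap

/-! ### The Gaussian energy -/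

section Energy

instance (n p : ℕ) : IsProbabilityMeasure (disorder n p) :=
  inferInstanceAs (IsProbabilityMeasure (Measure.pi fun _ => gaussianReal 0 1))

/-- The extensive energy `n H(σ)`, which is the exponent of the Boltzmann weight per unit of
inverse temperature. -/
noncomputable def energy (J : Tensor n p) (σ : Config n) : ℝ := n * hamiltonian J σ

/-- The coefficients of `energy` as a linear form in the disorder. -/
noncomputable def energyCoeff (p : ℕ) (σ : Config n) (I : Fin p → Fin n) : ℝ :=
  n * (n : ℝ) ^ (-((p : ℝ) + 1) / 2) * ∏ k, ((σ (I k) : ℤ) : ℝ)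

lemma energy_eq_sum (J : Tensor n p) (σ : Config n) :
    energy J σ = ∑ I, energyCoeff p σ I * J I := by
  simp only [energy, hamiltonian, energyCoeff, Finset.mul_sum]
  exact Finset.sum_congr rfl fun I _ => by ring

lemma measurable_energy (σ : Config n) : Measurable fun J : Tensor n p => energy J σ := by
  simp only [energy_eq_sum]
  fun_prop

lemma sum_energyCoeff_mul (p : ℕ) (σ τ : Config n) :
    ∑ I, energyCoeff p σ I * energyCoeff p τ I = n * overlap σ τ ^ p := by
  rcases Nat.eq_zero_or_pos n with rfl | hn
  · simp [energyCoeff]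
  have hn' : (0 : ℝ) < n := by exact_mod_cast hn
  have h_scale : ((n : ℝ) * (n : ℝ) ^ (-((p : ℝ) + 1) / 2)) ^ 2 = n / n ^ p := by
    rw [mul_pow, ← Real.rpow_mul_natCast hn'.le, Nat.cast_ofNat, div_mul_cancel₀ _ two_ne_zero,
      Real.rpow_neg hn'.le, Real.rpow_add_one hn'.ne', Real.rpow_natCast]
    field_simp
  have h_pow : (n * overlap σ τ) ^ p
      = ∑ I : Fin p → Fin n, ∏ k, ((σ (I k) : ℤ) : ℝ) * ((τ (I k) : ℤ) : ℝ) := by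
    rw [natCast_mul_overlap, Finset.sum_pow', Fintype.piFinset_univ]
  calc ∑ I, energyCoeff p σ I * energyCoeff p τ I
      = ∑ I : Fin p → Fin n, ((n : ℝ) * (n : ℝ) ^ (-((p : ℝ) + 1) / 2)) ^ 2
          * ∏ k, ((σ (I k) : ℤ) : ℝ) * ((τ (I k) : ℤ) : ℝ) := by
        refine Finset.sum_congr rfl fun I _ => ?_
        rw [energyCoeff, energyCoeff, Finset.prod_mul_distrib]
        ring
    _ = n * overlap σ τ ^ p := by
        rw [← Finset.mul_sum, ← h_pow, h_scale, mul_pow]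
        field_simp

lemma mul_energy_add_mul_energy (s t : ℝ) (σ τ : Config n) (J : Tensor n p) :
    s * energy J σ + t * energy J τ
      = ∑ I, (s * energyCoeff p σ I + t * energyCoeff p τ I) * J I := by
  simp only [energy_eq_sum, Finset.mul_sum, ← Finset.sum_add_distrib]
  exact Finset.sum_congr rfl fun I _ => by ring

lemma integrable_exp_energy_add (s t : ℝ) (σ τ : Config n) :
    Integrable (fun J : Tensor n p => Real.exp (s * energy J σ + t * energy J τ))
      (disorder n p) := by
  simp only [mul_energy_add_mul_energy]
  exact integrable_exp_sum_mul_pi_gaussianReal _ _ _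

lemma integral_exp_energy_add (s t : ℝ) (σ τ : Config n) :
    ∫ J : Tensor n p, Real.exp (s * energy J σ + t * energy J τ) ∂disorder n p
      = Real.exp (n * (s ^ 2 + t ^ 2 + 2 * s * t * overlap σ τ ^ p) / 2) := by
  have h_var : ∑ I, (s * energyCoeff p σ I + t * energyCoeff p τ I) ^ 2
      = n * (s ^ 2 + t ^ 2 + 2 * s * t * overlap σ τ ^ p) :=
    calc _ = s ^ 2 * ∑ I, energyCoeff p σ I * energyCoeff p σ I
          + t ^ 2 * ∑ I, energyCoeff p τ I * energyCoeff p τ I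
          + 2 * s * t * ∑ I, energyCoeff p σ I * energyCoeff p τ I := by
          simp only [Finset.mul_sum, ← Finset.sum_add_distrib]
          exact Finset.sum_congr rfl fun I _ => by ring
      _ = _ := by
          simp only [sum_energyCoeff_mul, natCast_mul_overlap_self_pow]
          ring
  simp only [mul_energy_add_mul_energy]
  refine (integral_exp_sum_mul_pi_gaussianReal _ _ _).trans ?_
  simp only [zero_mul, NNReal.coe_one, one_mul, zero_add, ← Finset.sum_div, h_var]

lemma integrable_exp_energy (t : ℝ) (σ : Config n) :
    Integrable (fun J : Tensor n p => Real.exp (t * energy J σ)) (disorder n p) := by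
  simpa using integrable_exp_energy_add t 0 σ σ

lemma integral_exp_energy (t : ℝ) (σ : Config n) :
    ∫ J : Tensor n p, Real.exp (t * energy J σ) ∂disorder n p = Real.exp (n * t ^ 2 / 2) := by
  simpa using integral_exp_energy_add (p := p) t 0 σ σ

lemma measureReal_le_energy_add_le {E : ℝ} (hE : 0 ≤ E) (σ τ : Config n) :
    (disorder n p).real {J | 2 * n * E ≤ energy J σ + energy J τ}
      ≤ Real.exp (n * E ^ 2 * (overlap σ τ ^ p - 1)) := by
  have h_int := integrable_exp_energy_add (p := p) E E σ τ
  simp only [← mul_add] at h_int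
  refine (measure_ge_le_exp_mul_mgf (X := fun J => energy J σ + energy J τ) (2 * n * E) hE
    h_int).trans_eq ?_
  simp only [mgf, mul_add, integral_exp_energy_add, ← Real.exp_add]
  ring_nf

lemma measureReal_exists_pair_le {E K q : ℝ} (hE : 0 ≤ E)
    {N : Config n → Finset (Config n)} (hcard : ∀ σ, ((N σ).card : ℝ) ≤ K)
    (hq : ∀ σ, ∀ τ ∈ N σ, overlap σ τ ^ p ≤ q) :
    (disorder n p).real {J | ∃ σ, ∃ τ ∈ N σ, 2 * n * E ≤ energy J σ + energy J τ}
      ≤ 2 ^ n * (K * Real.exp (n * E ^ 2 * (q - 1))) := by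
  have h_eq : {J : Tensor n p | ∃ σ, ∃ τ ∈ N σ, 2 * n * E ≤ energy J σ + energy J τ}
      = ⋃ σ ∈ (Finset.univ : Finset (Config n)), ⋃ τ ∈ N σ,
        {J | 2 * n * E ≤ energy J σ + energy J τ} := by
    ext J
    simp
  rw [h_eq]
  calc _ ≤ ∑ σ, ∑ τ ∈ N σ,
        (disorder n p).real {J | 2 * n * E ≤ energy J σ + energy J τ} :=
      (measureReal_biUnion_finset_le _ _).trans
        (Finset.sum_le_sum fun σ _ => measureReal_biUnion_finset_le _ _)
    _ ≤ ∑ σ, ∑ _τ ∈ N σ, Real.exp (n * E ^ 2 * (q - 1)) := by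
      gcongr with σ _ τ hτ
      refine (measureReal_le_energy_add_le hE σ τ).trans ?_
      gcongr
      exact hq σ τ hτ
    _ ≤ ∑ _σ : Config n, K * Real.exp (n * E ^ 2 * (q - 1)) := by
      refine Finset.sum_le_sum fun σ _ => ?_
      rw [Finset.sum_const, nsmul_eq_mul]
      gcongr
      exact hcard σ
    _ = 2 ^ n * (K * Real.exp (n * E ^ 2 * (q - 1))) := by simp

end Energy

/-! ### Tilted and truncated Boltzmann weights -/

section BoltzmannWeight

variable {β η : ℝ}

/-- The exponential `exp (β x)` tilted by `η` around the level `x = N (β + η)`. With `x` the energy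
of a configuration and `N = n`, this level is the mean of `x` under the tilted Gaussian law. -/
noncomputable def tiltedExp (β η N x : ℝ) : ℝ := Real.exp (β * x + η * (x - N * (β + η)))

lemma tiltedExp_pos (β η N x : ℝ) : 0 < tiltedExp β η N x := Real.exp_pos _

lemma exp_le_tiltedExp {N x : ℝ} (h : 0 ≤ η * (x - N * (β + η))) :
    Real.exp (β * x) ≤ tiltedExp β η N x :=
  Real.exp_le_exp.2 (le_add_of_nonneg_right h)

lemma tiltedExp_eq_mul (β η N x : ℝ) :
    tiltedExp β η N x = Real.exp (-(η * (N * (β + η)))) * Real.exp ((β + η) * x) := by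
  rw [tiltedExp, ← Real.exp_add]
  ring_nf

lemma integrable_tiltedExp_energy (β η N : ℝ) (σ : Config n) :
    Integrable (fun J : Tensor n p => tiltedExp β η N (energy J σ)) (disorder n p) := by
  simp only [tiltedExp_eq_mul]
  exact (integrable_exp_energy (β + η) σ).const_mul _

lemma integral_tiltedExp_energy (β η : ℝ) (σ : Config n) :
    ∫ J : Tensor n p, tiltedExp β η n (energy J σ) ∂disorder n p
      = Real.exp (n * β ^ 2 / 2) * Real.exp (-(η ^ 2 / 2 * n)) := by
  simp only [tiltedExp_eq_mul]
  rw [integral_const_mul, integral_exp_energy, ← Real.exp_add, ← Real.exp_add]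
  ring_nf

/-- The exponential `exp (β x)`, set to zero for `x > b`. With `x` the energy of a configuration,
this truncation of the Boltzmann weight keeps the second moment of the partition function from
being dominated by pairs of nearby configurations of exceptionally high energy. -/
noncomputable def truncExp (β b x : ℝ) : ℝ := if x ≤ b then Real.exp (β * x) else 0

lemma truncExp_nonneg (β b x : ℝ) : 0 ≤ truncExp β b x := by
  unfold truncExp
  split_ifs <;> positivity

lemma truncExp_le_exp (β b x : ℝ) : truncExp β b x ≤ Real.exp (β * x) := by
  unfold truncExp
  split_ifs
  exacts [le_rfl, (Real.exp_pos _).le]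

lemma truncExp_le_exp_mul (hβ : 0 ≤ β) (b x : ℝ) : truncExp β b x ≤ Real.exp (β * b) := by
  unfold truncExp
  split_ifs
  exacts [by gcongr, (Real.exp_pos _).le]

lemma measurable_truncExp (β b : ℝ) : Measurable (truncExp β b) :=
  Measurable.ite measurableSet_Iic (by fun_prop) measurable_const

lemma exp_sub_tiltedExp_le_truncExp (hη : 0 ≤ η) (β N x : ℝ) :
    Real.exp (β * x) - tiltedExp β η N x ≤ truncExp β (N * (β + η)) x := by
  unfold truncExp
  split_ifs with h
  · exact sub_le_self _ (tiltedExp_pos β η N x).le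
  · exact sub_nonpos.2 (exp_le_tiltedExp (mul_nonneg hη (sub_nonneg.2 (not_le.1 h).le)))

lemma truncExp_mul_le (β b x y : ℝ) :
    truncExp β b x * truncExp β b y ≤ Real.exp (β * x + β * y) := by
  rw [Real.exp_add]
  exact mul_le_mul (truncExp_le_exp β b x) (truncExp_le_exp β b y) (truncExp_nonneg β b y)
    (Real.exp_pos _).le

lemma truncExp_mul_le_of_nonneg (hβ : 0 ≤ β) (b x y : ℝ) :
    truncExp β b x * truncExp β b y
      ≤ Real.exp (β * b) * Real.exp (β / 2 * x + β / 2 * y) := by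
  by_cases h : x ≤ b ∧ y ≤ b
  · rw [truncExp, truncExp, if_pos h.1, if_pos h.2, ← Real.exp_add, ← Real.exp_add,
      Real.exp_le_exp]
    linarith [mul_le_mul_of_nonneg_left (add_le_add h.1 h.2) (by positivity : 0 ≤ β / 2)]
  · have h_zero : truncExp β b x * truncExp β b y = 0 := by
      rw [not_and_or] at h
      rcases h with h | h <;> simp [truncExp, h]
    rw [h_zero]
    positivity

lemma memLp_truncExp_energy (hβ : 0 ≤ β) (b : ℝ) (σ : Config n) :
    MemLp (fun J : Tensor n p => truncExp β b (energy J σ)) 2 (disorder n p) :=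
  MemLp.of_bound ((measurable_truncExp β b).comp (measurable_energy σ)).aestronglyMeasurable
    (Real.exp (β * b)) (.of_forall fun J => by
      rw [Real.norm_of_nonneg (truncExp_nonneg _ _ _)]
      exact truncExp_le_exp_mul hβ b _)

lemma integrable_truncExp_energy_mul (hβ : 0 ≤ β) (b : ℝ) (σ τ : Config n) :
    Integrable (fun J : Tensor n p => truncExp β b (energy J σ) * truncExp β b (energy J τ))
      (disorder n p) :=
  (memLp_truncExp_energy hβ b σ).integrable_mul (memLp_truncExp_energy hβ b τ)

lemma le_integral_truncExp_energy (hβ : 0 ≤ β) (hη : 0 ≤ η) (σ : Config n) :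
    Real.exp (n * β ^ 2 / 2) * (1 - Real.exp (-(η ^ 2 / 2 * n)))
      ≤ ∫ J : Tensor n p, truncExp β (n * (β + η)) (energy J σ) ∂disorder n p := by
  rw [mul_sub, mul_one, ← integral_tiltedExp_energy (p := p) β η σ,
    ← integral_exp_energy (p := p) β σ,
    ← integral_sub (integrable_exp_energy β σ) (integrable_tiltedExp_energy β η n σ)]
  exact integral_mono
    ((integrable_exp_energy β σ).sub (integrable_tiltedExp_energy β η n σ))
    ((memLp_truncExp_energy hβ _ σ).integrable one_le_two)
    fun J => exp_sub_tiltedExp_le_truncExp hη β n _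

lemma integral_truncExp_energy_mul_le (hβ : 0 ≤ β) (b : ℝ) (σ τ : Config n) :
    ∫ J : Tensor n p, truncExp β b (energy J σ) * truncExp β b (energy J τ) ∂disorder n p
      ≤ Real.exp (n * β ^ 2) * Real.exp (n * (β ^ 2 * |overlap σ τ| ^ p)) :=
  calc _ ≤ ∫ J : Tensor n p, Real.exp (β * energy J σ + β * energy J τ) ∂disorder n p :=
        integral_mono (integrable_truncExp_energy_mul hβ b σ τ) (integrable_exp_energy_add β β σ τ)
          fun J => truncExp_mul_le β b _ _
    _ = Real.exp (n * β ^ 2) * Real.exp (n * (β ^ 2 * overlap σ τ ^ p)) := by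
        rw [integral_exp_energy_add, ← Real.exp_add]
        ring_nf
    _ ≤ _ := by
        rw [← abs_pow]
        gcongr
        exact le_abs_self _

lemma integral_truncExp_energy_mul_le_of_nonneg (hβ : 0 ≤ β) (η : ℝ) (σ τ : Config n) :
    ∫ J : Tensor n p, truncExp β (n * (β + η)) (energy J σ)
        * truncExp β (n * (β + η)) (energy J τ) ∂disorder n p
      ≤ Real.exp (n * β ^ 2) * Real.exp (n * (β ^ 2 / 2 + β * η)) := by
  have h_pow : overlap σ τ ^ p ≤ 1 := (le_abs_self _).trans
    (abs_pow (overlap σ τ) p ▸ pow_le_one₀ (abs_nonneg _) (abs_overlap_le_one σ τ))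
  calc _ ≤ ∫ J : Tensor n p, Real.exp (β * (n * (β + η)))
          * Real.exp (β / 2 * energy J σ + β / 2 * energy J τ) ∂disorder n p :=
        integral_mono (integrable_truncExp_energy_mul hβ _ σ τ)
          ((integrable_exp_energy_add _ _ σ τ).const_mul _)
          fun J => truncExp_mul_le_of_nonneg hβ _ _ _
    _ = Real.exp (β * (n * (β + η))) * Real.exp (n * β ^ 2 / 4 * (1 + overlap σ τ ^ p)) := by
        rw [integral_const_mul, integral_exp_energy_add]
        ring_nf
    _ ≤ Real.exp (β * (n * (β + η))) * Real.exp (n * β ^ 2 / 4 * (1 + 1)) := by gcongr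
    _ = _ := by
        rw [← Real.exp_add, ← Real.exp_add]
        ring_nf

end BoltzmannWeight

/-! ### The partition function and its second moment -/

section SecondMoment

variable {β η γ r : ℝ}

/-- The annealed partition function `𝔼 Z_β = 2 ^ n exp (n β² / 2)`. -/
noncomputable def annealed (n : ℕ) (β : ℝ) : ℝ := 2 ^ n * Real.exp (n * β ^ 2 / 2)

lemma annealed_pos (n : ℕ) (β : ℝ) : 0 < annealed n β := by
  unfold annealed
  positivity

lemma annealed_sq (n : ℕ) (β : ℝ) :
    annealed n β ^ 2 = 2 ^ n * (2 ^ n * Real.exp (n * β ^ 2)) := by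
  rw [annealed, mul_pow, sq (Real.exp _), ← Real.exp_add, add_halves]
  ring

lemma partitionFunction_eq_sum (β : ℝ) (J : Tensor n p) :
    partitionFunction β J = ∑ σ, Real.exp (β * energy J σ) := by
  simp only [partitionFunction, energy, mul_assoc]

/-- The partition function restricted to the configurations of energy at most `n (β + η)`. -/
noncomputable def truncatedPartitionFunction (β η : ℝ) (J : Tensor n p) : ℝ :=
  ∑ σ, truncExp β (n * (β + η)) (energy J σ)

lemma truncatedPartitionFunction_le (β η : ℝ) (J : Tensor n p) :
    truncatedPartitionFunction β η J ≤ partitionFunction β J := by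
  rw [partitionFunction_eq_sum]
  exact Finset.sum_le_sum fun σ _ => truncExp_le_exp β _ _

lemma memLp_truncatedPartitionFunction (hβ : 0 ≤ β) (η : ℝ) :
    MemLp (fun J : Tensor n p => truncatedPartitionFunction β η J) 2 (disorder n p) :=
  memLp_finsetSum _ fun σ _ => memLp_truncExp_energy hβ _ σ

lemma le_integral_truncatedPartitionFunction (hβ : 0 ≤ β) (hη : 0 ≤ η) :
    annealed n β * (1 - Real.exp (-(η ^ 2 / 2 * n)))
      ≤ ∫ J : Tensor n p, truncatedPartitionFunction β η J ∂disorder n p := by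
  unfold truncatedPartitionFunction
  rw [integral_finsetSum _ fun σ _ => (memLp_truncExp_energy hβ _ σ).integrable one_le_two]
  calc annealed n β * (1 - Real.exp (-(η ^ 2 / 2 * n)))
      = ∑ _σ : Config n, Real.exp (n * β ^ 2 / 2) * (1 - Real.exp (-(η ^ 2 / 2 * n))) := by
        simp [annealed, mul_assoc]
    _ ≤ _ := Finset.sum_le_sum fun σ _ => le_integral_truncExp_energy hβ hη σ

lemma pow_three_div_eight_le (u : ℝ) (hu : 0 ≤ u) : u ^ 3 / 8 ≤ 16 * Real.exp (3 * u / 8) := by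
  have h_exp := Real.pow_div_factorial_le_exp (3 * u / 8) (by positivity) 3
  norm_num [Nat.factorial] at h_exp
  nlinarith [pow_nonneg hu 3]

-- With `u = N * R ^ 2` and `y = N * x` we have `y ≤ u ^ 3 / (8 * N ^ 2)` and `y ≤ u / 8`, so that
-- the correction `y * exp y` to `1` is at most `16 / N ^ 2 * exp (u / 2)`.
lemma exp_mul_le_one_add {N x R : ℝ} (hN : 0 < N) (hx : x ≤ R ^ 6 / 8) (hR : |R| ≤ 1) :
    Real.exp (N * x) ≤ 1 + 16 / N ^ 2 * Real.exp (N * R ^ 2 / 2) := by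
  have h_exp : Real.exp (N * x) ≤ 1 + N * x * Real.exp (N * x) := by
    have h_mul := mul_le_mul_of_nonneg_right (Real.one_sub_le_exp_neg (N * x))
      (Real.exp_pos (N * x)).le
    rw [← Real.exp_add, neg_add_cancel, Real.exp_zero] at h_mul
    linarith
  have h_cube : N * x ≤ (N * R ^ 2) ^ 3 / 8 / N ^ 2 :=
    calc N * x ≤ N * (R ^ 6 / 8) := by gcongr
      _ = (N * R ^ 2) ^ 3 / 8 / N ^ 2 := by field_simp
  have h_linear : N * x ≤ N * R ^ 2 / 8 := by
    have h_sq : (R ^ 2) ^ 3 ≤ R ^ 2 :=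
      pow_le_of_le_one (sq_nonneg R) (sq_le_one_iff_abs_le_one R |>.2 hR) three_ne_zero
    calc N * x ≤ N * ((R ^ 2) ^ 3 / 8) := by rw [← pow_mul]; gcongr
      _ ≤ N * R ^ 2 / 8 := by rw [mul_div_assoc]; gcongr
  refine h_exp.trans (add_le_add le_rfl ?_)
  calc N * x * Real.exp (N * x)
      ≤ (N * R ^ 2) ^ 3 / 8 / N ^ 2 * Real.exp (N * R ^ 2 / 8) := by gcongr
    _ ≤ 16 * Real.exp (3 * (N * R ^ 2) / 8) / N ^ 2 * Real.exp (N * R ^ 2 / 8) := by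
        gcongr
        exact pow_three_div_eight_le _ (by positivity)
    _ = 16 / N ^ 2 * (Real.exp (3 * (N * R ^ 2) / 8) * Real.exp (N * R ^ 2 / 8)) := by ring
    _ = 16 / N ^ 2 * Real.exp (N * R ^ 2 / 2) := by
        rw [← Real.exp_add]
        ring_nf

/-- A bound for `𝔼 Z² / (𝔼 Z)² - 1`, with `Z` the truncated partition function: the first term
comes from pairs of configurations with small overlap, the second one from the overlap caps. -/
noncomputable def momentExcess (γ : ℝ) (n : ℕ) : ℝ :=
  16 * (n + 1) / n ^ 2 + 2 * Real.exp (-(γ * n))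

lemma tendsto_momentExcess (hγ : 0 < γ) : Tendsto (momentExcess γ) atTop (𝓝 0) := by
  have h_inv : Tendsto (fun n : ℕ => (n : ℝ)⁻¹) atTop (𝓝 0) := tendsto_inv_atTop_nhds_zero_nat
  have h_lim := ((h_inv.add (h_inv.pow 2)).const_mul 16).add
    ((tendsto_exp_neg_mul_natCast hγ).const_mul 2)
  simp only [ne_eq, OfNat.ofNat_ne_zero, not_false_eq_true, zero_pow, add_zero, mul_zero] at h_lim
  refine h_lim.congr' ?_
  filter_upwards [eventually_gt_atTop 0] with n hn
  unfold momentExcess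
  field_simp

lemma sum_overlapCap_integral_truncExp_energy_mul_le (hβ : 0 ≤ β)
    (hγ : β ^ 2 / 2 + β * η + 2 * γ ≤ Real.log 2) {σ : Config n}
    (hcard : ((overlapCap r σ).card : ℝ) ≤ 2 * Real.exp (γ * n)) :
    ∑ τ ∈ overlapCap r σ, ∫ J : Tensor n p, truncExp β (n * (β + η)) (energy J σ)
        * truncExp β (n * (β + η)) (energy J τ) ∂disorder n p
      ≤ 2 ^ n * Real.exp (n * β ^ 2) * (2 * Real.exp (-(γ * n))) :=
  calc _ ≤ ∑ _τ ∈ overlapCap r σ, Real.exp (n * β ^ 2) * Real.exp (n * (β ^ 2 / 2 + β * η)) :=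
        Finset.sum_le_sum fun τ _ => integral_truncExp_energy_mul_le_of_nonneg hβ η σ τ
    _ ≤ 2 * Real.exp (γ * n)
          * (Real.exp (n * β ^ 2) * Real.exp (n * (Real.log 2 - 2 * γ))) := by
        rw [Finset.sum_const, nsmul_eq_mul]
        gcongr
        linarith
    _ = 2 * Real.exp (n * β ^ 2)
          * (Real.exp (γ * n) * Real.exp (n * (Real.log 2 - 2 * γ))) := by ring
    _ = 2 * Real.exp (n * β ^ 2)
          * (Real.exp (n * Real.log 2) * Real.exp (-(γ * n))) := by
        simp only [← Real.exp_add]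
        ring_nf
    _ = _ := by
        rw [two_pow_eq_exp]
        ring

lemma sum_compl_overlapCap_integral_truncExp_energy_mul_le (hn : 0 < n) (hβ : 0 ≤ β) (b : ℝ)
    (hcov : ∀ R : ℝ, |R| ≤ r → β ^ 2 * |R| ^ p ≤ R ^ 6 / 8) (σ : Config n) :
    ∑ τ ∈ (overlapCap r σ)ᶜ, ∫ J : Tensor n p, truncExp β b (energy J σ)
        * truncExp β b (energy J τ) ∂disorder n p
      ≤ 2 ^ n * Real.exp (n * β ^ 2) * (1 + 16 * (n + 1) / n ^ 2) := by
  have h_term : ∀ τ ∈ (overlapCap r σ)ᶜ,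
      ∫ J : Tensor n p, truncExp β b (energy J σ) * truncExp β b (energy J τ) ∂disorder n p
        ≤ Real.exp (n * β ^ 2) * (1 + 16 / n ^ 2 * Real.exp (n * overlap σ τ ^ 2 / 2)) := by
    intro τ hτ
    rw [Finset.mem_compl, mem_overlapCap, not_le] at hτ
    refine (integral_truncExp_energy_mul_le hβ b σ τ).trans ?_
    gcongr
    exact exp_mul_le_one_add (by positivity) (hcov _ hτ.le) (abs_overlap_le_one σ τ)
  calc _ ≤ ∑ τ ∈ (overlapCap r σ)ᶜ,
          Real.exp (n * β ^ 2) * (1 + 16 / n ^ 2 * Real.exp (n * overlap σ τ ^ 2 / 2)) :=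
        Finset.sum_le_sum h_term
    _ ≤ ∑ τ, Real.exp (n * β ^ 2) * (1 + 16 / n ^ 2 * Real.exp (n * overlap σ τ ^ 2 / 2)) :=
        Finset.sum_le_univ_sum_of_nonneg fun τ => by positivity
    _ = Real.exp (n * β ^ 2)
          * (2 ^ n + 16 / n ^ 2 * ∑ τ, Real.exp (n * overlap σ τ ^ 2 / 2)) := by
        simp [← Finset.mul_sum, Finset.sum_add_distrib]
    _ ≤ Real.exp (n * β ^ 2) * (2 ^ n + 16 / n ^ 2 * (2 ^ n * (n + 1))) := by
        gcongr
        exact sum_exp_half_mul_sq_overlap_le σ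
    _ = _ := by ring

lemma integral_truncatedPartitionFunction_sq_le (hn : 0 < n) (hβ : 0 ≤ β)
    (hγ : β ^ 2 / 2 + β * η + 2 * γ ≤ Real.log 2)
    (hcov : ∀ R : ℝ, |R| ≤ r → β ^ 2 * |R| ^ p ≤ R ^ 6 / 8)
    (hcard : ∀ σ : Config n, ((overlapCap r σ).card : ℝ) ≤ 2 * Real.exp (γ * n)) :
    ∫ J : Tensor n p, truncatedPartitionFunction β η J ^ 2 ∂disorder n p
      ≤ annealed n β ^ 2 * (1 + momentExcess γ n) := by
  have h_int (σ τ : Config n) := integrable_truncExp_energy_mul (p := p) hβ (n * (β + η)) σ τ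
  simp_rw [truncatedPartitionFunction, sq (Finset.sum _ _), Finset.sum_mul_sum]
  rw [integral_finsetSum _ fun σ _ => integrable_finsetSum _ fun τ _ => h_int σ τ]
  calc _ ≤ ∑ _σ : Config n, 2 ^ n * Real.exp (n * β ^ 2) * (1 + momentExcess γ n) := by
        refine Finset.sum_le_sum fun σ _ => ?_
        rw [integral_finsetSum _ fun τ _ => h_int σ τ,
          ← Finset.sum_add_sum_compl (overlapCap r σ)]
        have h_near := sum_overlapCap_integral_truncExp_energy_mul_le (p := p) hβ hγ (hcard σ)
        have h_far := sum_compl_overlapCap_integral_truncExp_energy_mul_le hn hβ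
          (n * (β + η)) hcov σ
        rw [momentExcess]
        linarith
    _ = annealed n β ^ 2 * (1 + momentExcess γ n) := by simp [annealed_sq, mul_assoc]

lemma measureReal_partitionFunction_lt_le (hn : 0 < n) (hβ : 0 ≤ β) (hη : 0 ≤ η)
    (hγ : β ^ 2 / 2 + β * η + 2 * γ ≤ Real.log 2)
    (hcov : ∀ R : ℝ, |R| ≤ r → β ^ 2 * |R| ^ p ≤ R ^ 6 / 8)
    (hcard : ∀ σ : Config n, ((overlapCap r σ).card : ℝ) ≤ 2 * Real.exp (γ * n)) :
    (disorder n p).real {J | partitionFunction β J < annealed n β / 2}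
      ≤ 4 * (momentExcess γ n + 2 * Real.exp (-(η ^ 2 / 2 * n))) :=
  (measureReal_mono fun J hJ => (truncatedPartitionFunction_le β η J).trans_lt hJ).trans
    (measureReal_lt_half_le_of_integral_sq_le (memLp_truncatedPartitionFunction hβ η)
      (annealed_pos n β) (le_integral_truncatedPartitionFunction hβ hη)
      (integral_truncatedPartitionFunction_sq_le hn hβ hγ hcov hcard))

end SecondMoment

/-! ### Concentration on the energy band -/

section Band

variable {β η : ℝ}

lemma exp_mul_le_tiltedExp_add_tiltedExp {N x : ℝ} (hN : 0 ≤ N) (hη : 0 ≤ η)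
    (hx : η ≤ |x - β|) :
    Real.exp (β * (N * x)) ≤ tiltedExp β η N (N * x) + tiltedExp β (-η) N (N * x) := by
  have h_level (t : ℝ) (h : 0 ≤ t * (x - (β + t))) :
      Real.exp (β * (N * x)) ≤ tiltedExp β t N (N * x) := by
    refine exp_le_tiltedExp ?_
    rw [← mul_sub, mul_left_comm]
    exact mul_nonneg hN h
  rcases le_abs.1 hx with h | h
  · exact le_add_of_le_of_nonneg (h_level η (mul_nonneg hη (by linarith)))
      (tiltedExp_pos _ _ _ _).le
  · exact le_add_of_nonneg_of_le (tiltedExp_pos _ _ _ _).le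
      (h_level (-η) (mul_nonneg_of_nonpos_of_nonpos (by linarith) (by linarith)))

lemma integral_sum_tiltedExp_energy (β η : ℝ) :
    ∫ J : Tensor n p, ∑ σ, tiltedExp β η n (energy J σ) ∂disorder n p
      = annealed n β * Real.exp (-(η ^ 2 / 2 * n)) := by
  rw [integral_finsetSum _ fun σ _ => integrable_tiltedExp_energy β η n σ]
  simp [integral_tiltedExp_energy, annealed, mul_assoc]

lemma measureReal_le_sum_exp_energy_le (β : ℝ) (hη : 0 ≤ η) :
    (disorder n p).real {J | annealed n β * Real.exp (-(η ^ 2 / 4 * n))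
        ≤ ∑ σ with η < |hamiltonian J σ - β|, Real.exp (β * energy J σ)}
      ≤ 2 * Real.exp (-(η ^ 2 / 4 * n)) := by
  let tiltedSum (t : ℝ) (J : Tensor n p) : ℝ := ∑ σ, tiltedExp β t n (energy J σ)
  have h_int (t : ℝ) : Integrable (tiltedSum t) (disorder n p) :=
    integrable_finsetSum _ fun σ _ => integrable_tiltedExp_energy β t n σ
  have h_nonneg (t : ℝ) (J : Tensor n p) : 0 ≤ tiltedSum t J :=
    Finset.sum_nonneg fun σ _ => (tiltedExp_pos _ _ _ _).le
  have h_le (J : Tensor n p) : ∑ σ with η < |hamiltonian J σ - β|, Real.exp (β * energy J σ)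
      ≤ tiltedSum η J + tiltedSum (-η) J := by
    rw [← Finset.sum_add_distrib]
    refine (Finset.sum_le_sum fun σ hσ => exp_mul_le_tiltedExp_add_tiltedExp (Nat.cast_nonneg n)
      hη (Finset.mem_filter.1 hσ).2.le).trans (Finset.sum_le_univ_sum_of_nonneg fun σ => ?_)
    exact add_nonneg (tiltedExp_pos _ _ _ _).le (tiltedExp_pos _ _ _ _).le
  have h_mean : ∫ J, (tiltedSum η J + tiltedSum (-η) J) ∂disorder n p
      = annealed n β * Real.exp (-(η ^ 2 / 4 * n)) * (2 * Real.exp (-(η ^ 2 / 4 * n))) := by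
    have h_sq : Real.exp (-(η ^ 2 / 2 * n)) = Real.exp (-(η ^ 2 / 4 * n)) ^ 2 := by
      rw [sq (Real.exp _), ← Real.exp_add]
      ring_nf
    rw [integral_add (h_int η) (h_int (-η)), integral_sum_tiltedExp_energy,
      integral_sum_tiltedExp_energy, neg_sq, h_sq]
    ring
  have h_markov := mul_meas_ge_le_integral_of_nonneg
    (.of_forall fun J => add_nonneg (h_nonneg η J) (h_nonneg (-η) J))
    ((h_int η).add (h_int (-η))) (annealed n β * Real.exp (-(η ^ 2 / 4 * n)))
  exact (measureReal_mono fun J hJ => le_trans hJ (h_le J)).trans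
    (le_of_mul_le_mul_left (h_markov.trans_eq h_mean) (mul_pos (annealed_pos n β) (Real.exp_pos _)))

end Band

/-! ### Clusterings -/

section Clustering

variable {ν₁ ν₂ : ℝ} {A : Finset (Config n)}

lemma exists_fin_fibers {α ι : Type*} [DecidableEq α] (f : α → ι) (A : Finset α) :
    ∃ (L : ℕ) (C : Fin L → Finset α), (∀ i, (C i).Nonempty) ∧ Finset.univ.biUnion C = A ∧
      ∀ i j, ∀ x ∈ C i, ∀ y ∈ C j, (f x = f y ↔ i = j) := by
  classical
  let e := (A.image f).equivFin
  refine ⟨(A.image f).card, fun i => {x ∈ A | f x = e.symm i}, fun i => ?_, ?_, ?_⟩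
  · obtain ⟨x, hx, hfx⟩ := Finset.mem_image.1 (e.symm i).2
    exact ⟨x, Finset.mem_filter.2 ⟨hx, hfx⟩⟩
  · refine Finset.Subset.antisymm (Finset.biUnion_subset.2 fun i _ => Finset.filter_subset _ _)
      fun x hx => ?_
    refine Finset.mem_biUnion.2 ⟨e ⟨f x, Finset.mem_image_of_mem f hx⟩, Finset.mem_univ _, ?_⟩
    simp [hx]
  · intro i j x hx y hy
    rw [(Finset.mem_filter.1 hx).2, (Finset.mem_filter.1 hy).2, Subtype.coe_inj,
      e.symm.injective.eq_iff]

/-- The configurations of `A` at Hamming distance at most `ν n` from `σ`. When no distance in `A`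
lies strictly between `ν₁ n` and `ν₂ n`, the sets `nearby ν₁ A σ` are the clusters of `A`. -/
noncomputable def nearby (ν : ℝ) (A : Finset (Config n)) (σ : Config n) : Finset (Config n) :=
  {τ ∈ A | (hammingDist σ τ : ℝ) ≤ ν * n}

lemma mem_nearby {ν : ℝ} {σ τ : Config n} :
    τ ∈ nearby ν A σ ↔ τ ∈ A ∧ (hammingDist σ τ : ℝ) ≤ ν * n :=
  Finset.mem_filter

lemma hammingDist_le_trans (hn : 0 < n) (hν : ν₁ < ν₂ / 2)
    (hA : ∀ σ ∈ A, ∀ τ ∈ A, (hammingDist σ τ : ℝ) ≤ ν₁ * n ∨ ν₂ * n ≤ hammingDist σ τ)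
    {σ τ ρ : Config n} (hσ : σ ∈ A) (hρ : ρ ∈ A) (hστ : (hammingDist σ τ : ℝ) ≤ ν₁ * n)
    (hτρ : (hammingDist τ ρ : ℝ) ≤ ν₁ * n) : (hammingDist σ ρ : ℝ) ≤ ν₁ * n := by
  have h_triangle : (hammingDist σ ρ : ℝ) ≤ hammingDist σ τ + hammingDist τ ρ := by
    exact_mod_cast hammingDist_triangle σ τ ρ
  have h_lt : ν₁ * n < ν₂ / 2 * n := by gcongr
  exact (hA σ hσ ρ hρ).resolve_right fun h => by linarith

lemma nearby_eq_nearby_iff (hn : 0 < n) (hν₁ : 0 ≤ ν₁) (hν : ν₁ < ν₂ / 2)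
    (hA : ∀ σ ∈ A, ∀ τ ∈ A, (hammingDist σ τ : ℝ) ≤ ν₁ * n ∨ ν₂ * n ≤ hammingDist σ τ)
    {σ τ : Config n} (hσ : σ ∈ A) (hτ : τ ∈ A) :
    nearby ν₁ A σ = nearby ν₁ A τ ↔ (hammingDist σ τ : ℝ) ≤ ν₁ * n := by
  constructor
  · intro h
    have h_self : τ ∈ nearby ν₁ A τ := by
      rw [mem_nearby, hammingDist_self, Nat.cast_zero]
      exact ⟨hτ, by positivity⟩
    exact (mem_nearby.1 (h ▸ h_self)).2
  · intro h
    ext ρ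
    simp only [mem_nearby]
    refine and_congr_right fun hρ => ⟨hammingDist_le_trans hn hν hA hτ hρ ?_,
      hammingDist_le_trans hn hν hA hσ hρ h⟩
    rwa [hammingDist_comm]

lemma exists_isClustering (hn : 0 < n) (hν₁ : 0 < ν₁) (hν : ν₁ < ν₂ / 2)
    (hA : ∀ σ ∈ A, ∀ τ ∈ A, (hammingDist σ τ : ℝ) ≤ ν₁ * n ∨ ν₂ * n ≤ hammingDist σ τ) :
    ∃ (L : ℕ) (C : Fin L → Finset (Config n)), IsClustering ν₁ ν₂ A C := by
  obtain ⟨L, C, h_nonempty, h_union, h_fiber⟩ := exists_fin_fibers (nearby ν₁ A) A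
  have h_mem {i : Fin L} {σ : Config n} (hσ : σ ∈ C i) : σ ∈ A :=
    h_union ▸ Finset.mem_biUnion.2 ⟨i, Finset.mem_univ i, hσ⟩
  have h_iff {i j : Fin L} {σ τ : Config n} (hσ : σ ∈ C i) (hτ : τ ∈ C j) :
      (hammingDist σ τ : ℝ) ≤ ν₁ * n ↔ i = j := by
    rw [← nearby_eq_nearby_iff hn hν₁.le hν hA (h_mem hσ) (h_mem hτ), h_fiber i j σ hσ τ hτ]
  exact ⟨L, C, {
    nonempty := h_nonempty
    disjoint := fun i j hij => Finset.disjoint_left.2 fun σ hσ hσ' =>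
      hij ((h_fiber i j σ hσ σ hσ').1 rfl)
    union := h_union
    within := fun i σ hσ τ hτ => (h_iff hσ hτ).2 rfl
    between := fun i j hij σ hσ τ hτ =>
      (hA σ (h_mem hσ) τ (h_mem hτ)).resolve_left fun h => hij ((h_iff hσ hτ).1 h) }⟩

lemma diam_le {r : ℝ} (hr : 0 ≤ r) (h : ∀ σ ∈ A, ∀ τ ∈ A, (hammingDist σ τ : ℝ) ≤ r) :
    (diam A : ℝ) ≤ r := by
  refine (Nat.le_floor_iff hr).1 (Finset.sup_le fun x hx => ?_)
  rw [Finset.mem_product] at hx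
  exact Nat.le_floor (h _ hx.1 _ hx.2)

lemma le_setDist {B : Finset (Config n)} (hA : A.Nonempty) (hB : B.Nonempty) {r : ℝ}
    (h : ∀ σ ∈ A, ∀ τ ∈ B, r ≤ hammingDist σ τ) : r ≤ setDist A B := by
  obtain ⟨σ, hσ⟩ := hA
  obtain ⟨τ, hτ⟩ := hB
  obtain ⟨σ', hσ', τ', hτ', h_eq⟩ := Nat.sInf_mem
    (s := {d : ℕ | ∃ x ∈ A, ∃ y ∈ B, hammingDist x y = d}) ⟨_, σ, hσ, τ, hτ, rfl⟩
  rw [setDist, ← h_eq]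
  exact h σ' hσ' τ' hτ'

end Clustering

/-! ### Gibbs masses -/

section Gibbs

variable {β η γ D : ℝ} {J : Tensor n p} {A : Finset (Config n)}

lemma partitionFunction_pos (β : ℝ) (J : Tensor n p) : 0 < partitionFunction β J :=
  Finset.sum_pos (fun _ _ => Real.exp_pos _) Finset.univ_nonempty

lemma gibbs_eq_sum_div (β : ℝ) (J : Tensor n p) (A : Finset (Config n)) :
    gibbs β J A = (∑ σ ∈ A, Real.exp (β * energy J σ)) / partitionFunction β J := by
  simp only [gibbs, energy, mul_assoc]

lemma one_sub_le_gibbs (hZ : annealed n β / 2 ≤ partitionFunction β J) (hD : 0 ≤ D)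
    (h_compl : ∑ σ ∈ Aᶜ, Real.exp (β * energy J σ) ≤ annealed n β * D) :
    1 - 2 * D ≤ gibbs β J A := by
  have h_split := Finset.sum_add_sum_compl A fun σ => Real.exp (β * energy J σ)
  rw [← partitionFunction_eq_sum] at h_split
  rw [gibbs_eq_sum_div, le_div_iff₀ (partitionFunction_pos β J)]
  have h_mul := mul_le_mul_of_nonneg_right hZ hD
  linarith

lemma gibbs_le_of_card_le (hβ : 0 ≤ β) (hγ : β ^ 2 / 2 + β * η + 2 * γ ≤ Real.log 2)
    (hZ : annealed n β / 2 ≤ partitionFunction β J) (hA : ∀ σ ∈ A, hamiltonian J σ ≤ β + η)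
    (hcard : (A.card : ℝ) ≤ 2 * Real.exp (γ * n)) :
    gibbs β J A ≤ 4 * Real.exp (-(γ * n)) := by
  rw [gibbs_eq_sum_div, div_le_iff₀ (partitionFunction_pos β J)]
  calc ∑ σ ∈ A, Real.exp (β * energy J σ)
      ≤ ∑ _σ ∈ A, Real.exp (β * (n * (β + η))) := by
        unfold energy
        gcongr with σ hσ
        exact hA σ hσ
    _ ≤ 2 * Real.exp (γ * n) * Real.exp (β * (n * (β + η))) := by
        rw [Finset.sum_const, nsmul_eq_mul]
        gcongr
    _ = 2 * Real.exp (n * (β ^ 2 / 2 + β * η + 2 * γ) + (n * β ^ 2 / 2 - γ * n)) := by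
        rw [mul_assoc, ← Real.exp_add]
        ring_nf
    _ ≤ 2 * Real.exp (n * Real.log 2 + (n * β ^ 2 / 2 - γ * n)) := by gcongr
    _ = 4 * Real.exp (-(γ * n)) * (annealed n β / 2) := by
        rw [annealed, two_pow_eq_exp, Real.exp_add, sub_eq_add_neg, Real.exp_add]
        ring
    _ ≤ 4 * Real.exp (-(γ * n)) * partitionFunction β J := by gcongr

lemma gibbs_biUnion_le {L : ℕ} {C : Fin L → Finset (Config n)} {b : ℝ}
    (h_disjoint : ∀ i j, i ≠ j → Disjoint (C i) (C j)) (hb : ∀ i, gibbs β J (C i) ≤ b) :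
    gibbs β J (Finset.univ.biUnion C) ≤ L * b := by
  have h_sum : gibbs β J (Finset.univ.biUnion C) = ∑ i, gibbs β J (C i) := by
    rw [gibbs, Finset.sum_biUnion fun i _ j _ hij => h_disjoint i j hij, Finset.sum_div]
    rfl
  calc gibbs β J (Finset.univ.biUnion C) ≤ ∑ _i : Fin L, b :=
        h_sum.trans_le (Finset.sum_le_sum fun i _ => hb i)
    _ = L * b := by simp

lemma le_logb_of_half_le_mul_exp {L : ℕ} (hn : 0 < n) (hγn : 4 * Real.log 2 ≤ γ * n)
    (h : 1 / 2 ≤ L * Real.exp (-(γ / 2) * n)) :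
    γ / (4 * Real.log 2) ≤ 1 / (n : ℝ) * Real.logb 2 L := by
  have h_half : (1 / 2 : ℝ) = Real.exp (-Real.log 2) := by
    rw [Real.exp_neg, Real.exp_log two_pos, one_div]
  have h_exp : Real.exp (γ / 4 * n) ≤ L := by
    refine le_of_mul_le_mul_right (le_trans ?_ h) (Real.exp_pos (-(γ / 2) * n))
    rw [← Real.exp_add, h_half, Real.exp_le_exp]
    linarith
  have h_log : γ / 4 * n ≤ Real.log L :=
    (Real.le_log_iff_exp_le ((Real.exp_pos _).trans_le h_exp)).2 h_exp
  rw [Real.logb, one_div_mul_eq_div, div_div, div_mul_eq_div_div,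
    le_div_iff₀ (mul_pos (Real.log_pos one_lt_two) (Nat.cast_pos.2 hn))]
  refine le_trans (le_of_eq ?_) h_log
  field_simp

end Gibbs

/-! ### Shattering -/

section Shattering

/-- The half-width of `energyBand β κ J`, a band around the energy density `β`. -/
noncomputable def bandHalfWidth (κ : ℝ) : ℝ := κ * √(2 * Real.log 2)

lemma mem_energyBand {β κ : ℝ} {J : Tensor n p} {σ : Config n} :
    σ ∈ energyBand β κ J ↔ |hamiltonian J σ - β| ≤ bandHalfWidth κ := by
  simp [energyBand, bandHalfWidth]

lemma compl_energyBand (β κ : ℝ) (J : Tensor n p) :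
    (energyBand β κ J)ᶜ = Finset.univ.filter fun σ => bandHalfWidth κ < |hamiltonian J σ - β| := by
  ext σ
  simp [mem_energyBand]

/-- The configurations whose Hamming distance to `σ` lies strictly between `ν₁ n` and `ν₂ n`, the
range that separates the clusters. -/
noncomputable def gapShell (ν₁ ν₂ : ℝ) (σ : Config n) : Finset (Config n) :=
  {τ | ν₁ * n < hammingDist σ τ ∧ (hammingDist σ τ : ℝ) < ν₂ * n}

lemma mem_gapShell {ν₁ ν₂ : ℝ} {σ τ : Config n} :
    τ ∈ gapShell ν₁ ν₂ σ ↔ ν₁ * n < hammingDist σ τ ∧ (hammingDist σ τ : ℝ) < ν₂ * n := by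
  simp [gapShell]

lemma hammingDist_le_or_le_of_mem_energyBand {β κ ν₁ ν₂ : ℝ} {J : Tensor n p}
    (h_pair : ¬ ∃ σ, ∃ τ ∈ gapShell ν₁ ν₂ σ,
      2 * n * (β - bandHalfWidth κ) ≤ energy J σ + energy J τ) :
    ∀ σ ∈ energyBand β κ J, ∀ τ ∈ energyBand β κ J,
      (hammingDist σ τ : ℝ) ≤ ν₁ * n ∨ ν₂ * n ≤ hammingDist σ τ := by
  intro σ hσ τ hτ
  by_contra! h_gap
  refine h_pair ⟨σ, τ, mem_gapShell.2 h_gap, ?_⟩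
  rw [mem_energyBand] at hσ hτ
  have h_sum : 2 * (β - bandHalfWidth κ) ≤ hamiltonian J σ + hamiltonian J τ := by
    linarith [(abs_le.1 hσ).1, (abs_le.1 hτ).1]
  calc 2 * n * (β - bandHalfWidth κ) = n * (2 * (β - bandHalfWidth κ)) := by ring
    _ ≤ n * (hamiltonian J σ + hamiltonian J τ) := by gcongr
    _ = energy J σ + energy J τ := by simp only [energy, mul_add]

/-- Parameters for which the `p`-spin Gibbs measure at inverse temperature `β` shatters: `η` is the
half-width of the energy band, `ν₁` and `ν₂` are the scales of the clustering, and `γ` is the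
margin, an exponential rate, that is left in every entropy and energy estimate. -/
structure Admissible (β η γ ν₁ ν₂ : ℝ) (p : ℕ) : Prop where
  β_pos : 0 < β
  η_pos : 0 < η
  γ_pos : 0 < γ
  ν₁_pos : 0 < ν₁
  ν₁_lt : ν₁ < ν₂ / 2
  ν₂_le : ν₂ ≤ 1 / 4
  η_le : η ≤ β
  log_two_le : Real.log 2 + 3 * γ ≤ (β - η) ^ 2
  le_log_two : β ^ 2 / 2 + β * η + 2 * γ ≤ Real.log 2
  card_overlapCap_le : ∀ (n : ℕ) (σ : Config n),
    ((overlapCap (1 - 2 * ν₂) σ).card : ℝ) ≤ 2 * Real.exp (γ * n)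
  covariance_le : ∀ R : ℝ, |R| ≤ 1 - 2 * ν₂ → β ^ 2 * |R| ^ p ≤ R ^ 6 / 8
  pair_energy_le : (β - η) ^ 2 * (1 - 2 * ν₁) ^ p ≤ γ

namespace Admissible

variable {β η κ γ ν₁ ν₂ : ℝ}

lemma card_gapShell_le (h : Admissible β η γ ν₁ ν₂ p) (hn : 0 < n) (σ : Config n) :
    ((gapShell ν₁ ν₂ σ).card : ℝ) ≤ 2 * Real.exp (γ * n) := by
  refine le_trans (Nat.cast_le.2 (Finset.card_le_card fun τ hτ => ?_)) (h.card_overlapCap_le n σ)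
  exact mem_overlapCap_of_hammingDist_le hn (mem_gapShell.1 hτ).2.le

lemma overlap_pow_le_of_mem_gapShell (h : Admissible β η γ ν₁ ν₂ p) (hn : 0 < n)
    {σ τ : Config n} (hτ : τ ∈ gapShell ν₁ ν₂ σ) : overlap σ τ ^ p ≤ (1 - 2 * ν₁) ^ p := by
  have hn' : (0 : ℝ) < n := Nat.cast_pos.2 hn
  obtain ⟨h_lower, h_upper⟩ := mem_gapShell.1 hτ
  have h_overlap := natCast_mul_overlap_eq_sub σ τ
  have h_quarter : ν₂ * n ≤ 1 / 4 * n := by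
    have := h.ν₂_le
    gcongr
  refine pow_le_pow_left₀ ?_ ?_ p
  · exact nonneg_of_mul_nonneg_right (by linarith) hn'
  · exact le_of_mul_le_mul_left (by linarith) hn'

lemma measureReal_exists_gap_pair_le (h : Admissible β η γ ν₁ ν₂ p) (hn : 0 < n) :
    (disorder n p).real {J | ∃ σ, ∃ τ ∈ gapShell ν₁ ν₂ σ,
        2 * n * (β - η) ≤ energy J σ + energy J τ}
      ≤ 2 * Real.exp (-(γ * n)) :=
  calc _ ≤ 2 ^ n * (2 * Real.exp (γ * n)
          * Real.exp (n * (β - η) ^ 2 * ((1 - 2 * ν₁) ^ p - 1))) :=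
        measureReal_exists_pair_le (sub_nonneg.2 h.η_le) (h.card_gapShell_le hn)
          fun _ _ hτ => h.overlap_pow_le_of_mem_gapShell hn hτ
    _ = 2 * Real.exp (n * (Real.log 2 + γ + (β - η) ^ 2 * (1 - 2 * ν₁) ^ p - (β - η) ^ 2)) := by
        rw [two_pow_eq_exp, mul_assoc 2, mul_left_comm, ← Real.exp_add, ← Real.exp_add]
        ring_nf
    _ ≤ 2 * Real.exp (n * -γ) := by
        have := h.log_two_le
        have := h.pair_energy_le
        gcongr
        linarith
    _ = 2 * Real.exp (-(γ * n)) := by rw [mul_neg, mul_comm (n : ℝ)]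

lemma gibbs_cluster_le (h : Admissible β (bandHalfWidth κ) γ ν₁ ν₂ p) (hn : 0 < n)
    (hγn : 4 * Real.log 2 ≤ γ * n) {J : Tensor n p}
    (hZ : annealed n β / 2 ≤ partitionFunction β J) {A : Finset (Config n)} (hA : A.Nonempty)
    (h_band : A ⊆ energyBand β κ J)
    (h_within : ∀ σ ∈ A, ∀ τ ∈ A, (hammingDist σ τ : ℝ) ≤ ν₁ * n) :
    gibbs β J A ≤ Real.exp (-(γ / 2) * n) := by
  obtain ⟨σ, hσ⟩ := hA
  have h_card : (A.card : ℝ) ≤ 2 * Real.exp (γ * n) := by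
    refine le_trans (Nat.cast_le.2 (Finset.card_le_card fun τ hτ => ?_)) (h.card_overlapCap_le n σ)
    refine mem_overlapCap_of_hammingDist_le hn ((h_within σ hσ τ hτ).trans ?_)
    gcongr
    linarith [h.ν₁_lt, h.ν₁_pos]
  have h_hamiltonian : ∀ τ ∈ A, hamiltonian J τ ≤ β + bandHalfWidth κ := fun τ hτ => by
    linarith [(abs_le.1 (mem_energyBand.1 (h_band hτ))).2]
  have h_four : (4 : ℝ) = Real.exp (2 * Real.log 2) := by
    rw [mul_comm, Real.exp_mul, Real.exp_log two_pos]
    norm_num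
  calc gibbs β J A ≤ 4 * Real.exp (-(γ * n)) :=
        gibbs_le_of_card_le h.β_pos.le h.le_log_two hZ h_hamiltonian h_card
    _ = Real.exp (2 * Real.log 2 + -(γ * n)) := by rw [h_four, ← Real.exp_add]
    _ ≤ Real.exp (-(γ / 2) * n) := Real.exp_le_exp.2 (by linarith)

lemma isShatteredBy_of_isClustering (h : Admissible β (bandHalfWidth κ) γ ν₁ ν₂ p) (hn : 0 < n)
    (hγn : 4 * Real.log 2 ≤ γ * n) {D : ℝ} (hD₀ : 0 ≤ D) (hD : D ≤ 1 / 4) {J : Tensor n p}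
    (hZ : annealed n β / 2 ≤ partitionFunction β J)
    (h_compl : ∑ σ ∈ (energyBand β κ J)ᶜ, Real.exp (β * energy J σ) ≤ annealed n β * D)
    {L : ℕ} {C : Fin L → Finset (Config n)} (hC : IsClustering ν₁ ν₂ (energyBand β κ J) C) :
    IsShatteredBy β (2 * ν₁) ν₂ (γ / (4 * Real.log 2)) (γ / 2) (2 * D) J C := by
  have h_subdominant (i : Fin L) : gibbs β J (C i) ≤ Real.exp (-(γ / 2) * n) := by
    refine h.gibbs_cluster_le hn hγn hZ (hC.nonempty i) ?_ (hC.within i)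
    rw [← hC.union]
    exact Finset.subset_biUnion_of_mem C (Finset.mem_univ i)
  have h_collective : 1 - 2 * D ≤ gibbs β J (Finset.univ.biUnion C) := by
    rw [hC.union]
    exact one_sub_le_gibbs hZ hD₀ h_compl
  have hν₁n : 0 ≤ ν₁ * n := mul_nonneg h.ν₁_pos.le (Nat.cast_nonneg n)
  exact {
    nonempty := hC.nonempty
    exponentially_many := le_logb_of_half_le_mul_exp hn hγn
      (by linarith [gibbs_biUnion_le hC.disjoint h_subdominant])
    confined := fun i => (diam_le hν₁n (hC.within i)).trans (by linarith)
    separated := fun i j hij => le_setDist (hC.nonempty i) (hC.nonempty j)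
      (hC.between i j hij.ne)
    subdominant := h_subdominant
    collective := h_collective }

/-- A bound for the probability that shattering fails, the sum of the failure probabilities of the
distance gap, of the lower bound on the partition function and of the concentration of the Gibbs
measure on the energy band. -/
noncomputable def failureBound (η γ : ℝ) (n : ℕ) : ℝ :=
  2 * Real.exp (-(γ * n)) + 4 * (momentExcess γ n + 2 * Real.exp (-(η ^ 2 / 2 * n)))
    + 2 * Real.exp (-(η ^ 2 / 4 * n))

lemma tendsto_failureBound (hη : 0 < η) (hγ : 0 < γ) :
    Tendsto (failureBound η γ) atTop (𝓝 0) := by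
  have h_gap := (tendsto_exp_neg_mul_natCast hγ).const_mul 2
  have h_moment := ((tendsto_momentExcess hγ).add ((tendsto_exp_neg_mul_natCast
    (show 0 < η ^ 2 / 2 by positivity)).const_mul 2)).const_mul 4
  have h_band := (tendsto_exp_neg_mul_natCast (show 0 < η ^ 2 / 4 by positivity)).const_mul 2
  have h_lim := (h_gap.add h_moment).add h_band
  simp only [mul_zero, add_zero] at h_lim
  exact h_lim

/-- The event that some clustering of the energy band shatters the Gibbs measure. -/
def shatteringEvent (n p : ℕ) (β κ ν₁ ν₂ c c' δ : ℝ) : Set (Tensor n p) :=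
  {J | ∃ (L : ℕ) (C : Fin L → Finset (Config n)),
    IsShatteredBy β (2 * ν₁) ν₂ c c' δ J C ∧ IsClustering ν₁ ν₂ (energyBand β κ J) C}

lemma measureReal_compl_shatteringEvent_le (h : Admissible β (bandHalfWidth κ) γ ν₁ ν₂ p)
    (hn : 0 < n) (hγn : 4 * Real.log 2 ≤ γ * n)
    (hD : Real.exp (-(bandHalfWidth κ ^ 2 / 4 * n)) ≤ 1 / 4) :
    (disorder n p).real (shatteringEvent n p β κ ν₁ ν₂ (γ / (4 * Real.log 2)) (γ / 2)
        (2 * Real.exp (-(bandHalfWidth κ ^ 2 / 4 * n))))ᶜ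
      ≤ failureBound (bandHalfWidth κ) γ n := by
  have h_gap := h.measureReal_exists_gap_pair_le hn
  have h_partition := measureReal_partitionFunction_lt_le hn h.β_pos.le h.η_pos.le h.le_log_two
    h.covariance_le (h.card_overlapCap_le n)
  have h_band := measureReal_le_sum_exp_energy_le (n := n) (p := p) β h.η_pos.le
  refine le_trans (measureReal_mono fun J hJ => ?_) ((measureReal_union_le _ _).trans
    (add_le_add ((measureReal_union_le _ _).trans (add_le_add h_gap h_partition)) h_band))
  by_contra h_good
  simp only [Set.mem_union, Set.mem_ofPred_eq, not_or, not_lt, not_le] at h_good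
  obtain ⟨⟨h_pair, hZ⟩, h_compl⟩ := h_good
  rw [← compl_energyBand] at h_compl
  obtain ⟨L, C, hC⟩ := exists_isClustering hn h.ν₁_pos h.ν₁_lt
    (hammingDist_le_or_le_of_mem_energyBand h_pair)
  exact hJ ⟨L, C, h.isShatteredBy_of_isClustering hn hγn (Real.exp_pos _).le hD hZ h_compl.le hC,
    hC⟩

lemma tendsto_measure_shatteringEvent (h : Admissible β (bandHalfWidth κ) γ ν₁ ν₂ p) :
    Tendsto (fun n => disorder n p (shatteringEvent n p β κ ν₁ ν₂ (γ / (4 * Real.log 2)) (γ / 2)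
      (2 * Real.exp (-(bandHalfWidth κ ^ 2 / 4 * n))))) atTop (𝓝 1) := by
  have hη := h.η_pos
  refine tendsto_measure_one_of_measureReal_compl_le (tendsto_failureBound hη h.γ_pos) ?_
  have h_exp := (tendsto_exp_neg_mul_natCast
    (show 0 < bandHalfWidth κ ^ 2 / 4 by positivity)).eventually_le_const
    (show (0 : ℝ) < 1 / 4 by norm_num)
  have h_linear := (tendsto_natCast_atTop_atTop.const_mul_atTop h.γ_pos).eventually_ge_atTop
    (4 * Real.log 2)
  filter_upwards [eventually_gt_atTop 0, h_linear, h_exp] with n hn hγn hD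
  exact h.measureReal_compl_shatteringEvent_le hn hγn hD

end Admissible

end Shattering

/-! ### Choice of the parameters -/

section Parameters

variable {β η : ℝ}

lemma exists_bandHalfWidth (hβ₁ : √(Real.log 2) < β) (hβ₂ : β < √(2 * Real.log 2)) :
    ∃ κ₀ : ℝ, 0 < κ₀ ∧ ∀ κ : ℝ, κ < κ₀ → √(Real.log 2) < β - bandHalfWidth κ ∧
      β ^ 2 / 2 + β * bandHalfWidth κ < Real.log 2 := by
  have hβ : 0 < β := (Real.sqrt_nonneg _).trans_lt hβ₁
  have h_sq : β ^ 2 < 2 * Real.log 2 := (Real.lt_sqrt hβ.le).1 hβ₂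
  have h_sqrt : 0 < √(2 * Real.log 2) := hβ.trans hβ₂
  refine ⟨min (β - √(Real.log 2)) ((Real.log 2 - β ^ 2 / 2) / β) / √(2 * Real.log 2),
    div_pos (lt_min (sub_pos.2 hβ₁) (div_pos (by linarith) hβ)) h_sqrt, fun κ hκ => ?_⟩
  rw [lt_div_iff₀ h_sqrt, lt_min_iff, lt_div_iff₀ hβ] at hκ
  rw [bandHalfWidth]
  constructor <;> linarith

lemma mul_abs_pow_le_of_abs_le {a s R : ℝ} (ha : 0 ≤ a) (hp : 6 ≤ p)
    (hs : a * s ^ (p - 6) ≤ 1 / 8) (hR : |R| ≤ s) : a * |R| ^ p ≤ R ^ 6 / 8 :=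
  calc a * |R| ^ p = a * |R| ^ (p - 6) * R ^ 6 := by
        rw [mul_assoc, ← Even.pow_abs (by decide : Even 6) R, ← pow_add, Nat.sub_add_cancel hp]
    _ ≤ a * s ^ (p - 6) * R ^ 6 := by gcongr
    _ ≤ 1 / 8 * R ^ 6 := by gcongr
    _ = R ^ 6 / 8 := by ring

lemma exists_admissible (hβ : 0 < β) (hη : 0 < η) (hηβ : η ≤ β)
    (h_gap : Real.log 2 < (β - η) ^ 2) (h_moment : β ^ 2 / 2 + β * η < Real.log 2) :
    ∃ (γ ν₁ ν₂ : ℝ) (P : ℕ), ∀ p, P ≤ p → Admissible β η γ ν₁ ν₂ p := by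
  obtain ⟨γ, hγ, hγ_gap, hγ_moment⟩ : ∃ γ : ℝ, 0 < γ ∧ Real.log 2 + 3 * γ ≤ (β - η) ^ 2 ∧
      β ^ 2 / 2 + β * η + 2 * γ ≤ Real.log 2 := by
    refine ⟨min (((β - η) ^ 2 - Real.log 2) / 3) ((Real.log 2 - (β ^ 2 / 2 + β * η)) / 2),
      lt_min (by linarith) (by linarith), ?_, ?_⟩
    · linarith [min_le_left (((β - η) ^ 2 - Real.log 2) / 3)
        ((Real.log 2 - (β ^ 2 / 2 + β * η)) / 2)]
    · linarith [min_le_right (((β - η) ^ 2 - Real.log 2) / 3)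
        ((Real.log 2 - (β ^ 2 / 2 + β * η)) / 2)]
  obtain ⟨r, hr, h_cap⟩ := exists_card_overlapCap_le hγ
  obtain ⟨ν, hν, hν_quarter, hν_cap⟩ : ∃ ν : ℝ, 0 < ν ∧ ν ≤ 1 / 4 ∧ r ≤ 1 - 2 * ν :=
    ⟨min ((1 - r) / 2) (1 / 4), lt_min (by linarith) (by norm_num), min_le_right _ _,
      by linarith [min_le_left ((1 - r) / 2) (1 / 4)]⟩
  have h_covariance : ∀ᶠ p in atTop, β ^ 2 * (1 - 2 * ν) ^ (p - 6) ≤ 1 / 8 := by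
    have h_lim := ((tendsto_pow_atTop_nhds_zero_of_lt_one (by linarith)
      (show 1 - 2 * ν < 1 by linarith)).comp (tendsto_sub_atTop_nat 6)).const_mul (β ^ 2)
    rw [mul_zero] at h_lim
    exact h_lim.eventually_le_const (by norm_num)
  have h_pair : ∀ᶠ p in atTop, (β - η) ^ 2 * (1 - 2 * (ν / 4)) ^ p ≤ γ := by
    have h_lim := (tendsto_pow_atTop_nhds_zero_of_lt_one (by linarith)
      (show 1 - 2 * (ν / 4) < 1 by linarith)).const_mul ((β - η) ^ 2)
    rw [mul_zero] at h_lim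
    exact h_lim.eventually_le_const hγ
  obtain ⟨P, hP⟩ := eventually_atTop.1 (h_covariance.and (h_pair.and (eventually_ge_atTop 6)))
  refine ⟨γ, ν / 4, ν, P, fun p hp => ?_⟩
  obtain ⟨hp_covariance, hp_pair, hp_six⟩ := hP p hp
  exact ⟨hβ, hη, hγ, by positivity, by linarith, hν_quarter, hηβ, hγ_gap, hγ_moment,
    fun n σ => le_trans (Nat.cast_le.2 (Finset.card_le_card (overlapCap_anti hν_cap σ)))
      (h_cap n σ),
    fun R hR => mul_abs_pow_le_of_abs_le (sq_nonneg β) hp_six hp_covariance hR, hp_pair⟩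

end Parameters

end IsingPSpin

open IsingPSpin

theorem mainTheorem1 (β : ℝ) (hβ₁ : √(Real.log 2) < β) (hβ₂ : β < √(2 * Real.log 2)) :
    ∃ κ₀ : ℝ, 0 < κ₀ ∧ ∀ κ : ℝ, 0 < κ → κ < κ₀ →
      ∃ (P : ℕ) (ν₁ ν₂ c c' : ℝ),
        0 < ν₁ ∧ ν₁ < ν₂ / 2 ∧ ν₂ < 1 ∧ 0 < c ∧ 0 < c' ∧
        ∀ p : ℕ, P ≤ p →
          ∃ δ : ℕ → ℝ, Filter.Tendsto δ Filter.atTop (nhds 0) ∧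
            Filter.Tendsto
              (fun n : ℕ => IsingPSpin.disorder n p
                {J | ∃ (L : ℕ) (C : Fin L → Finset (IsingPSpin.Config n)),
                  IsingPSpin.IsShatteredBy β (2 * ν₁) ν₂ c c' (δ n) J C ∧
                  IsingPSpin.IsClustering ν₁ ν₂ (IsingPSpin.energyBand β κ J) C})
              Filter.atTop (nhds 1) := by
  have hβ : 0 < β := (Real.sqrt_nonneg _).trans_lt hβ₁
  have h_log : 0 < Real.log 2 := Real.log_pos one_lt_two
  obtain ⟨κ₀, hκ₀, h_width⟩ := exists_bandHalfWidth hβ₁ hβ₂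
  refine ⟨κ₀, hκ₀, fun κ hκ hκκ₀ => ?_⟩
  obtain ⟨h_gap, h_moment⟩ := h_width κ hκκ₀
  have hη : 0 < bandHalfWidth κ := mul_pos hκ (Real.sqrt_pos.2 (mul_pos two_pos h_log))
  have hηβ : 0 < β - bandHalfWidth κ := (Real.sqrt_nonneg _).trans_lt h_gap
  obtain ⟨γ, ν₁, ν₂, P, h⟩ := exists_admissible hβ hη (sub_pos.1 hηβ).le
    ((Real.sqrt_lt' hηβ).1 h_gap) h_moment
  have hγ := (h P le_rfl).γ_pos
  refine ⟨P, ν₁, ν₂, γ / (4 * Real.log 2), γ / 2, (h P le_rfl).ν₁_pos, (h P le_rfl).ν₁_lt,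
    (h P le_rfl).ν₂_le.trans_lt (by norm_num), by positivity, by positivity, fun p hp =>
      ⟨fun n => 2 * Real.exp (-(bandHalfWidth κ ^ 2 / 4 * n)), ?_,
        (h p hp).tendsto_measure_shatteringEvent⟩⟩
  simpa only [mul_zero] using
    (tendsto_exp_neg_mul_natCast (show 0 < bandHalfWidth κ ^ 2 / 4 by positivity)).const_mul 2
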